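/- Fix a nonzero abelian group $G$ and let $H_n(U)$, $n\in\mathbb{Z}$, denote the reduced singular homology of a (possibly empty) topological space $U$ with coefficients in $G$, that is, the homology of the augmented singular chain complex $\cdots\to C_1(U;G)\to C_0(U;G)\to G\to 0$ with $G$ in degree $-1$; in particular, $H_{-1}(U)=0$ if and only if $U$ is nonempty. Theorem $\Sigma_m$. Let $m\ge 1$ and let $F=\{A_1,\dots,A_m\}$ be a family of open subsets of a topological space $X$. Suppose that for every $1\le j\le m$ and every subfamily $F'\subset F$ of size $j$, $$H_{j-2}\Bigl(\bigcup F'\Bigr)=0.$$ Then $\bigcap F=A_1\cap\dots\cap A_m\neq\varnothing$. -/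

import Mathlib

open CategoryTheory Limits AlgebraicTopology

universe u

/-- The reduced singular homology `H_n(X; G)`, `n : ℤ`, of a (possibly empty) topological space `X`
with coefficients in an abelian group `G`, that is, the homology of the augmented singular chain
complex `⋯ → C₁(X; G) → C₀(X; G) → G → 0`, with `G` placed in degree `-1`.
It is ordinary singular homology in degrees `n ≥ 1`, the kernel of the augmentation
`ε : H₀(X; G) → G` in degree `0`, the cokernel of `ε` in degree `-1`, and `0` in degrees `≤ -2`. -/
noncomputable def reducedSingularHomology (G : Type u) [AddCommGroup G] (X : Type u)
    [TopologicalSpace X] : ℤ → AddCommGrpCat.{u}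
  | Int.ofNat 0 => kernel ((TopCat.of X).singularHomology₀ε (AddCommGrpCat.of G))
  | Int.ofNat (n + 1) =>
      ((singularHomologyFunctor AddCommGrpCat.{u} (n + 1)).obj (AddCommGrpCat.of G)).obj
        (TopCat.of X)
  | Int.negSucc 0 => cokernel ((TopCat.of X).singularHomology₀ε (AddCommGrpCat.of G))
  | Int.negSucc (_ + 1) => AddCommGrpCat.of PUnit

/-- `H₋₁(X; G) = 0` if and only if `X` is nonempty. -/
theorem subsingleton_reducedSingularHomology_neg_one_iff (G : Type u) [AddCommGroup G]
    [Nontrivial G] (X : Type u) [TopologicalSpace X] :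
    Subsingleton (reducedSingularHomology G X (-1)) ↔ Nonempty X := by
  change Subsingleton ((cokernel ((TopCat.of X).singularHomology₀ε (AddCommGrpCat.of G)) :
    AddCommGrpCat.{u})) ↔ _
  rw [← AddCommGrpCat.isZero_iff_subsingleton]
  constructor
  · intro h
    by_contra hX
    rw [not_nonempty_iff] at hX
    have : IsEmpty (ZerothHomotopy X) := Quotient.instIsEmpty
    have hz : (TopCat.of X).singularHomology₀ε (AddCommGrpCat.of G) = 0 := by
      rw [← TopCat.singularHomology₀Iso_sigma_desc_id,
        ← cancel_epi (TopCat.singularHomology₀Iso _ _).inv]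
      refine Sigma.hom_ext _ _ fun x => ?_
      exact (this.false x).elim
    have hG : IsZero (AddCommGrpCat.of G) := by
      have e : cokernel ((TopCat.of X).singularHomology₀ε (AddCommGrpCat.of G)) ≅
        AddCommGrpCat.of G := cokernelIsoOfEq hz ≪≫ cokernelZeroIsoTarget
      exact h.of_iso e.symm
    rw [AddCommGrpCat.isZero_iff_subsingleton] at hG
    exact not_subsingleton G hG
  · rintro ⟨x⟩
    have : Epi ((TopCat.of X).singularHomology₀ε (AddCommGrpCat.of G)) := by
      rw [← TopCat.singularHomology₀Iso_sigma_desc_id]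
      have : Epi (Sigma.desc
          (fun (_ : ZerothHomotopy (TopCat.of X)) ↦ 𝟙 (AddCommGrpCat.of G))) := by
        apply epi_of_epi_fac (f := Sigma.ι
          (fun (_ : ZerothHomotopy (TopCat.of X)) ↦ (AddCommGrpCat.of G)) (Quotient.mk _ x)) (h := 𝟙 _)
        simp
      infer_instance
    exact isZero_cokernel_of_epi _

/-! Suppose the intersection is empty, and label each point `x` by an index `l x` with `x ∉ A (l
x)`; no continuity of `l` is needed. The vanishing of homology allows filling dimension by
dimension: each strictly increasing tuple `ρ` of indices receives a singular chain in `⋃ a, A (ρ a)`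
whose boundary is the alternating sum of the chains of its faces, starting from some `g ≠ 0` on the
empty tuple (`fillingChain_spec`). Subdividing `k` times and reading off the labels of the vertices
gives a chain map from the augmented complex of the simplex on the indices to the same complex with
coefficients in `G`.

By Lebesgue's number lemma, for large `k` every small simplex in the chain of `ρ` has all its
vertices in a single `A (ρ b)`, so the label `ρ b` does not occur on it. Hence all diagonal
coefficients in degrees `≥ 0` vanish (`eventually_chainCount_eq_zero`). Since the augmented complex
of a simplex is contractible, the coefficient in degree `-1` must vanish too
(`augmentation_eq_zero_of_forall_diagonal_eq_zero`). But that coefficient is `g`.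

Simplices are indexed by their number `n` of vertices, hence have degree `n - 1`; the case `n = 0`
is the augmentation. -/

/-- Alternating double sums over codimension-two faces vanish. -/
theorem sum_neg_one_pow_succAbove_succAbove {M : Type*} [AddCommGroup M] {n : ℕ}
    (F : (Fin n → Fin (n + 2)) → M) :
    ∑ i : Fin (n + 2), (-1 : ℤ) ^ (i : ℕ) • ∑ j : Fin (n + 1),
      (-1 : ℤ) ^ (j : ℕ) • F (i.succAbove ∘ j.succAbove) = 0 := by
  simp_rw [Finset.smul_sum]
  rw [← Fintype.sum_prod_type' (f := fun (i : Fin (n + 2)) (j : Fin (n + 1)) =>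
    (-1 : ℤ) ^ (i : ℕ) • (-1 : ℤ) ^ (j : ℕ) • F (i.succAbove ∘ j.succAbove))]
  -- The involution exchanges the two orders in which the same pair of vertices can be deleted; the
  -- signs are opposite.
  refine Finset.sum_involution (fun p _ => (p.1.succAbove p.2, p.2.predAbove p.1)) ?_ ?_ ?_ ?_
  · rintro ⟨i, j⟩ -
    have h : (i.succAbove j).succAbove ∘ (j.predAbove i).succAbove = i.succAbove ∘ j.succAbove := by
      ext a
      simp [Fin.succAbove_succAbove_succAbove_predAbove]
    simp only [h, smul_smul, ← add_smul, ← pow_add]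
    rw [Fin.neg_one_pow_succAbove_add_predAbove]
    simp
  · rintro ⟨i, j⟩ - - h
    exact Fin.succAbove_ne i j (congrArg Prod.fst h)
  · simp
  · rintro ⟨i, j⟩ -
    simp [Fin.succAbove_succAbove_predAbove, Fin.predAbove_predAbove_succAbove]

/-! ### Augmented chains of ordered tuples, and cones -/

/-- The boundary of ordered tuples, augmented by the empty tuple. -/
noncomputable def tupleBoundary (P : Type*) (n : ℕ) :
    ((Fin (n + 1) → P) →₀ ℤ) →ₗ[ℤ] ((Fin n → P) →₀ ℤ) :=
  Finsupp.linearCombination ℤ fun τ =>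
    ∑ i : Fin (n + 1), (-1 : ℤ) ^ (i : ℕ) • Finsupp.single (τ ∘ i.succAbove) 1

theorem tupleBoundary_single {P : Type*} {n : ℕ} (τ : Fin (n + 1) → P) :
    tupleBoundary P n (Finsupp.single τ 1) =
      ∑ i : Fin (n + 1), (-1 : ℤ) ^ (i : ℕ) • Finsupp.single (τ ∘ i.succAbove) 1 := by
  simp [tupleBoundary]

theorem tupleBoundary_tupleBoundary {P : Type*} {n : ℕ} (c : (Fin (n + 2) → P) →₀ ℤ) :
    tupleBoundary P n (tupleBoundary P (n + 1) c) = 0 := by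
  suffices h : tupleBoundary P n ∘ₗ tupleBoundary P (n + 1) = 0 from LinearMap.congr_fun h c
  refine Finsupp.lhom_ext' fun τ => LinearMap.ext_ring ?_
  simp only [LinearMap.comp_apply, Finsupp.lsingle_apply, tupleBoundary_single, map_sum, map_smul]
  exact sum_neg_one_pow_succAbove_succAbove fun f => Finsupp.single (τ ∘ f) (1 : ℤ)

/-- The map on chains of tuples induced by a map of vertices. -/
noncomputable def tupleMap {P Q : Type*} (h : P → Q) (n : ℕ) :
    ((Fin n → P) →₀ ℤ) →ₗ[ℤ] ((Fin n → Q) →₀ ℤ) :=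
  Finsupp.lmapDomain ℤ ℤ fun τ => h ∘ τ

theorem tupleMap_single {P Q : Type*} (h : P → Q) {n : ℕ} (τ : Fin n → P) :
    tupleMap h n (Finsupp.single τ 1) = Finsupp.single (h ∘ τ) 1 := by
  simp [tupleMap]

theorem tupleMap_tupleMap {P Q R : Type*} (h : P → Q) (h' : Q → R) {n : ℕ}
    (c : (Fin n → P) →₀ ℤ) : tupleMap h' n (tupleMap h n c) = tupleMap (h' ∘ h) n c := by
  suffices H : tupleMap h' n ∘ₗ tupleMap h n = tupleMap (h' ∘ h) n from LinearMap.congr_fun H c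
  refine Finsupp.lhom_ext' fun τ => LinearMap.ext_ring ?_
  simp [tupleMap_single, Function.comp_assoc]

theorem tupleMap_tupleBoundary {P Q : Type*} (h : P → Q) {n : ℕ} (c : (Fin (n + 1) → P) →₀ ℤ) :
    tupleMap h n (tupleBoundary P n c) = tupleBoundary Q n (tupleMap h (n + 1) c) := by
  suffices H : tupleMap h n ∘ₗ tupleBoundary P n = tupleBoundary Q n ∘ₗ tupleMap h (n + 1) from
    LinearMap.congr_fun H c
  refine Finsupp.lhom_ext' fun τ => LinearMap.ext_ring ?_
  simp only [LinearMap.comp_apply, Finsupp.lsingle_apply, tupleBoundary_single, tupleMap_single,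
    map_sum, map_smul, Function.comp_assoc]

/-- The cone with apex `b` on a chain of tuples. -/
noncomputable def tupleCone {P : Type*} (b : P) (n : ℕ) :
    ((Fin n → P) →₀ ℤ) →ₗ[ℤ] ((Fin (n + 1) → P) →₀ ℤ) :=
  Finsupp.lmapDomain ℤ ℤ fun τ => (Fin.cons b τ : Fin (n + 1) → P)

theorem tupleCone_single {P : Type*} (b : P) {n : ℕ} (τ : Fin n → P) :
    tupleCone b n (Finsupp.single τ 1) = Finsupp.single (Fin.cons b τ : Fin (n + 1) → P) 1 := by
  simp [tupleCone]

theorem cons_comp_succAbove_zero {P : Type*} (b : P) {n : ℕ} (τ : Fin n → P) :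
    (Fin.cons b τ : Fin (n + 1) → P) ∘ (0 : Fin (n + 1)).succAbove = τ := by
  ext; simp

theorem cons_comp_succAbove_succ {P : Type*} (b : P) {n : ℕ} (τ : Fin (n + 1) → P)
    (i : Fin (n + 1)) :
    (Fin.cons b τ : Fin (n + 2) → P) ∘ i.succ.succAbove =
      (Fin.cons b (τ ∘ i.succAbove) : Fin (n + 1) → P) := by
  ext j
  cases j using Fin.cases <;> simp

theorem tupleBoundary_tupleCone_zero {P : Type*} (b : P) (c : (Fin 0 → P) →₀ ℤ) :
    tupleBoundary P 0 (tupleCone b 0 c) = c := by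
  suffices H : tupleBoundary P 0 ∘ₗ tupleCone b 0 = LinearMap.id from LinearMap.congr_fun H c
  refine Finsupp.lhom_ext' fun τ => LinearMap.ext_ring ?_
  simp only [LinearMap.comp_apply, Finsupp.lsingle_apply, tupleCone_single, tupleBoundary_single]
  simp [Subsingleton.elim _ τ]

theorem tupleBoundary_tupleCone {P : Type*} (b : P) {n : ℕ} (c : (Fin (n + 1) → P) →₀ ℤ) :
    tupleBoundary P (n + 1) (tupleCone b (n + 1) c) = c - tupleCone b n (tupleBoundary P n c) := by
  suffices H : tupleBoundary P (n + 1) ∘ₗ tupleCone b (n + 1) =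
      LinearMap.id - tupleCone b n ∘ₗ tupleBoundary P n from LinearMap.congr_fun H c
  refine Finsupp.lhom_ext' fun τ => LinearMap.ext_ring ?_
  simp only [LinearMap.comp_apply, Finsupp.lsingle_apply, tupleCone_single, tupleBoundary_single,
    LinearMap.sub_apply, LinearMap.id_apply, map_sum, map_smul]
  rw [Fin.sum_univ_succ, cons_comp_succAbove_zero]
  simp only [cons_comp_succAbove_succ, Fin.val_zero, Fin.val_succ, pow_zero, one_smul, pow_succ,
    mul_neg_one, neg_smul, Finset.sum_neg_distrib, sub_eq_add_neg]

/-! ### Barycentric subdivision of tuples -/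

/-- The subdivision of a tuple, with respect to a choice `β` of a barycenter for each tuple. -/
noncomputable def tupleSubdivision {P : Type*} (β : ∀ n, (Fin (n + 1) → P) → P) :
    ∀ n, (Fin n → P) → ((Fin n → P) →₀ ℤ)
  | 0, τ => Finsupp.single τ 1
  | n + 1, τ => tupleCone (β n τ) n (∑ i : Fin (n + 1), (-1 : ℤ) ^ (i : ℕ) •
      tupleSubdivision β n (τ ∘ i.succAbove))

/-- The subdivision operator on chains of tuples. -/
noncomputable def chainSubdivision {P : Type*} (β : ∀ n, (Fin (n + 1) → P) → P) (n : ℕ) :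
    ((Fin n → P) →₀ ℤ) →ₗ[ℤ] ((Fin n → P) →₀ ℤ) :=
  Finsupp.linearCombination ℤ (tupleSubdivision β n)

theorem chainSubdivision_single {P : Type*} (β : ∀ n, (Fin (n + 1) → P) → P) {n : ℕ}
    (τ : Fin n → P) : chainSubdivision β n (Finsupp.single τ 1) = tupleSubdivision β n τ := by
  simp [chainSubdivision]

theorem tupleSubdivision_succ {P : Type*} (β : ∀ n, (Fin (n + 1) → P) → P) {n : ℕ}
    (τ : Fin (n + 1) → P) : tupleSubdivision β (n + 1) τ =
      tupleCone (β n τ) n (chainSubdivision β n (tupleBoundary P n (Finsupp.single τ 1))) := by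
  simp only [tupleSubdivision, tupleBoundary_single, chainSubdivision_single, map_sum, map_smul]

theorem chainSubdivision_zero {P : Type*} (β : ∀ n, (Fin (n + 1) → P) → P)
    (c : (Fin 0 → P) →₀ ℤ) : chainSubdivision β 0 c = c := by
  suffices H : chainSubdivision β 0 = LinearMap.id from LinearMap.congr_fun H c
  refine Finsupp.lhom_ext' fun τ => LinearMap.ext_ring ?_
  simp [chainSubdivision_single, tupleSubdivision]

theorem tupleBoundary_chainSubdivision {P : Type*} (β : ∀ n, (Fin (n + 1) → P) → P) {n : ℕ}
    (c : (Fin (n + 1) → P) →₀ ℤ) :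
    tupleBoundary P n (chainSubdivision β (n + 1) c) =
      chainSubdivision β n (tupleBoundary P n c) := by
  suffices H : tupleBoundary P n ∘ₗ chainSubdivision β (n + 1) =
      chainSubdivision β n ∘ₗ tupleBoundary P n from LinearMap.congr_fun H c
  induction n with
  | zero =>
    refine Finsupp.lhom_ext' fun τ => LinearMap.ext_ring ?_
    simp only [LinearMap.comp_apply, Finsupp.lsingle_apply, chainSubdivision_single,
      tupleSubdivision_succ, tupleBoundary_tupleCone_zero]
  | succ n ih =>
    refine Finsupp.lhom_ext' fun τ => LinearMap.ext_ring ?_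
    -- The cone on `Sd ∂τ` has boundary `Sd ∂τ` minus the cone on `∂ Sd ∂τ = Sd ∂∂τ = 0`. The chain
    -- passed to `ih` is a dummy argument.
    have h := LinearMap.congr_fun (ih (tupleBoundary P _ c))
      (tupleBoundary P (n + 1) (Finsupp.single τ 1))
    simp only [LinearMap.comp_apply, tupleBoundary_tupleBoundary, map_zero] at h
    simp only [LinearMap.comp_apply, Finsupp.lsingle_apply, chainSubdivision_single,
      tupleSubdivision_succ, tupleBoundary_tupleCone, h, map_zero, sub_zero]

theorem tupleMap_tupleCone {P Q : Type*} (h : P → Q) (b : P) {n : ℕ} (c : (Fin n → P) →₀ ℤ) :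
    tupleMap h (n + 1) (tupleCone b n c) = tupleCone (h b) n (tupleMap h n c) := by
  suffices H : tupleMap h (n + 1) ∘ₗ tupleCone b n = tupleCone (h b) n ∘ₗ tupleMap h n from
    LinearMap.congr_fun H c
  refine Finsupp.lhom_ext' fun τ => LinearMap.ext_ring ?_
  simp only [LinearMap.comp_apply, Finsupp.lsingle_apply, tupleCone_single, tupleMap_single]
  congr 1
  ext j
  cases j using Fin.cases <;> simp

theorem tupleMap_chainSubdivision {P Q : Type*} {β : ∀ n, (Fin (n + 1) → P) → P}
    {β' : ∀ n, (Fin (n + 1) → Q) → Q} {h : P → Q} (hβ : ∀ n τ, h (β n τ) = β' n (h ∘ τ)) {n : ℕ}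
    (c : (Fin n → P) →₀ ℤ) :
    tupleMap h n (chainSubdivision β n c) = chainSubdivision β' n (tupleMap h n c) := by
  suffices H : tupleMap h n ∘ₗ chainSubdivision β n = chainSubdivision β' n ∘ₗ tupleMap h n from
    LinearMap.congr_fun H c
  induction n with
  | zero =>
    refine LinearMap.ext fun c => ?_
    simp only [LinearMap.comp_apply, chainSubdivision_zero]
  | succ n ih =>
    refine Finsupp.lhom_ext' fun τ => LinearMap.ext_ring ?_
    have ih' := LinearMap.congr_fun (ih (tupleBoundary P _ c))
      (tupleBoundary P n (Finsupp.single τ 1))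
    simp only [LinearMap.comp_apply] at ih'
    simp only [LinearMap.comp_apply, Finsupp.lsingle_apply, chainSubdivision_single,
      tupleSubdivision_succ, tupleMap_tupleCone, hβ, ih', tupleMap_tupleBoundary, tupleMap_single]

theorem tupleBoundary_iterate_chainSubdivision {P : Type*} (β : ∀ n, (Fin (n + 1) → P) → P)
    {n : ℕ} (k : ℕ) (c : (Fin (n + 1) → P) →₀ ℤ) :
    tupleBoundary P n ((chainSubdivision β (n + 1))^[k] c) =
      (chainSubdivision β n)^[k] (tupleBoundary P n c) :=
  (Function.Semiconj.iterate_right (f := tupleBoundary P n)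
    (fun c => tupleBoundary_chainSubdivision β c) k) c

theorem tupleMap_iterate_chainSubdivision {P Q : Type*} {β : ∀ n, (Fin (n + 1) → P) → P}
    {β' : ∀ n, (Fin (n + 1) → Q) → Q} {h : P → Q} (hβ : ∀ n τ, h (β n τ) = β' n (h ∘ τ)) {n : ℕ}
    (k : ℕ) (c : (Fin n → P) →₀ ℤ) :
    tupleMap h n ((chainSubdivision β n)^[k] c) =
      (chainSubdivision β' n)^[k] (tupleMap h n c) :=
  (Function.Semiconj.iterate_right (f := tupleMap h n)
    (fun c => tupleMap_chainSubdivision hβ c) k) c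

/-! ### Oriented simplices as determinants -/

/-- The coefficient of the oriented simplex `κ` in the ordered simplex `τ`. -/
def tupleDet {V : Type*} [DecidableEq V] {n : ℕ} (κ τ : Fin n → V) : ℤ :=
  (Matrix.of fun a b => if τ a = κ b then (1 : ℤ) else 0).det

theorem tupleDet_comp_perm {V : Type*} [DecidableEq V] {n : ℕ} (κ τ : Fin n → V)
    (σ : Equiv.Perm (Fin n)) : tupleDet (κ ∘ σ) τ = Equiv.Perm.sign σ * tupleDet κ τ :=
  Matrix.det_permute' σ (Matrix.of fun a b => if τ a = κ b then (1 : ℤ) else 0)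

theorem tupleDet_eq_zero_of_not_injective {V : Type*} [DecidableEq V] {n : ℕ} {κ : Fin n → V}
    (hκ : ¬ Function.Injective κ) (τ : Fin n → V) : tupleDet κ τ = 0 := by
  obtain ⟨a, b, hab, hne⟩ := Function.not_injective_iff.1 hκ
  exact Matrix.det_zero_of_column_eq hne fun i => by simp [hab]

theorem tupleDet_eq_zero_of_forall_ne {V : Type*} [DecidableEq V] {n : ℕ} {κ τ : Fin n → V}
    (b : Fin n) (h : ∀ a, τ a ≠ κ b) : tupleDet κ τ = 0 :=
  Matrix.det_eq_zero_of_column_eq_zero b fun i => by simp [h i]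

/-- Laplace expansion along the first column, the only one depending on `v`: row `i` contributes
exactly for `v = τ i`. -/
theorem sum_tupleDet_cons {V : Type*} [DecidableEq V] [Fintype V] {n : ℕ} (κ : Fin n → V)
    (τ : Fin (n + 1) → V) : ∑ v, tupleDet (Fin.cons v κ : Fin (n + 1) → V) τ =
      ∑ i : Fin (n + 1), (-1 : ℤ) ^ (i : ℕ) * tupleDet κ (τ ∘ i.succAbove) := by
  have h (v : V) : tupleDet (Fin.cons v κ : Fin (n + 1) → V) τ = ∑ i : Fin (n + 1),
      if τ i = v then (-1 : ℤ) ^ (i : ℕ) * tupleDet κ (τ ∘ i.succAbove) else 0 := by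
    rw [tupleDet, Matrix.det_succ_column_zero]
    refine Finset.sum_congr rfl fun i _ => ?_
    simp only [Matrix.of_apply, Fin.cons_zero]
    split_ifs
    · rw [mul_one]
      rfl
    · simp
  simp_rw [h]
  rw [Finset.sum_comm]
  simp

/-- The coefficient of the oriented simplex `κ` in a chain of tuples. -/
noncomputable def tuplePairing {V : Type*} [DecidableEq V] {n : ℕ} (κ : Fin n → V) :
    ((Fin n → V) →₀ ℤ) →ₗ[ℤ] ℤ :=
  Finsupp.linearCombination ℤ (tupleDet κ)

theorem tuplePairing_single {V : Type*} [DecidableEq V] {n : ℕ} (κ τ : Fin n → V) :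
    tuplePairing κ (Finsupp.single τ 1) = tupleDet κ τ := by
  simp [tuplePairing]

theorem sum_tuplePairing_cons {V : Type*} [DecidableEq V] [Fintype V] {n : ℕ} (κ : Fin n → V)
    (c : (Fin (n + 1) → V) →₀ ℤ) : ∑ v, tuplePairing (Fin.cons v κ : Fin (n + 1) → V) c =
      tuplePairing κ (tupleBoundary V n c) := by
  suffices H : ∑ v, tuplePairing (Fin.cons v κ : Fin (n + 1) → V) =
      tuplePairing κ ∘ₗ tupleBoundary V n by simpa using LinearMap.congr_fun H c
  refine Finsupp.lhom_ext' fun τ => LinearMap.ext_ring ?_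
  simp only [LinearMap.comp_apply, Finsupp.lsingle_apply, LinearMap.sum_apply, tuplePairing_single,
    sum_tupleDet_cons, tupleBoundary_single, map_sum, map_smul, smul_eq_mul]

theorem tuplePairing_comp_perm {V : Type*} [DecidableEq V] {n : ℕ} (κ : Fin n → V)
    (σ : Equiv.Perm (Fin n)) (c : (Fin n → V) →₀ ℤ) :
    tuplePairing (κ ∘ σ) c = Equiv.Perm.sign σ * tuplePairing κ c := by
  simp only [tuplePairing, Finsupp.linearCombination_apply, tupleDet_comp_perm, Finsupp.mul_sum,
    smul_eq_mul, mul_left_comm]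

theorem tuplePairing_eq_zero_of_not_injective {V : Type*} [DecidableEq V] {n : ℕ} {κ : Fin n → V}
    (hκ : ¬ Function.Injective κ) (c : (Fin n → V) →₀ ℤ) : tuplePairing κ c = 0 := by
  simp [tuplePairing, Finsupp.linearCombination_apply, tupleDet_eq_zero_of_not_injective hκ]

theorem tuplePairing_eq_zero_of_forall_exists {V : Type*} [DecidableEq V] {n : ℕ} {κ : Fin n → V}
    {c : (Fin n → V) →₀ ℤ} (h : ∀ τ ∈ c.support, ∃ b, ∀ a, τ a ≠ κ b) : tuplePairing κ c = 0 := by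
  rw [tuplePairing, Finsupp.linearCombination_apply]
  refine Finset.sum_eq_zero fun τ hτ => ?_
  obtain ⟨b, hb⟩ := h τ hτ
  simp [tupleDet_eq_zero_of_forall_ne b hb]

/-! ### Vanishing of the Lefschetz number on a simplex -/

/-- Pairs of a strictly increasing tuple and a vertex not on it correspond to pairs of a strictly
increasing tuple with one more vertex and a position in it. -/
theorem sum_orderEmbedding_insert {M : Type*} [AddCommMonoid M] {m n : ℕ}
    (f : (Fin n ↪o Fin m) → Fin m → M) (hf : ∀ ρ : Fin n ↪o Fin m, ∀ v ∈ Set.range ρ, f ρ v = 0) :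
    ∑ ρ, ∑ v, f ρ v =
      ∑ ρ : Fin (n + 1) ↪o Fin m, ∑ i, f ((Fin.succAboveOrderEmb i).trans ρ) (ρ i) := by
  rw [← Fintype.sum_prod_type', ← Fintype.sum_prod_type'
    (f := fun (ρ : Fin (n + 1) ↪o Fin m) i => f ((Fin.succAboveOrderEmb i).trans ρ) (ρ i))]
  have hrange (ρ : Fin (n + 1) ↪o Fin m) (i : Fin (n + 1)) : Set.range ρ =
      insert (ρ i) (Set.range ((Fin.succAboveOrderEmb i).trans ρ)) := by
    ext x
    simp only [Set.mem_range, Set.mem_insert_iff]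
    constructor
    · rintro ⟨j, rfl⟩
      obtain rfl | ⟨j, rfl⟩ := Fin.eq_self_or_eq_succAbove i j
      · exact Or.inl rfl
      · exact Or.inr ⟨j, rfl⟩
    · rintro (rfl | ⟨j, rfl⟩)
      exacts [⟨i, rfl⟩, ⟨i.succAbove j, rfl⟩]
  symm
  refine Finset.sum_of_injOn (fun p => ((Fin.succAboveOrderEmb p.2).trans p.1, p.1 p.2)) ?_
    (by simp) ?_ (by simp)
  · rintro ⟨ρ, i⟩ - ⟨ρ', i'⟩ - h
    simp only [Prod.mk.injEq] at h
    obtain rfl : ρ = ρ' := by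
      rw [← OrderEmbedding.range_inj, hrange ρ i, hrange ρ' i', h.1, h.2]
    rw [ρ.injective h.2]
  · rintro ⟨ρ, v⟩ - h
    refine hf ρ v ?_
    by_contra hv
    refine h ?_
    classical
    have hcard : (insert v (Finset.univ.map ρ.toEmbedding)).card = n + 1 := by
      rw [Finset.card_insert_of_notMem (by simpa using hv)]
      simp
    set ρ' := (insert v (Finset.univ.map ρ.toEmbedding)).orderEmbOfFin hcard with hρ'
    have hr : Set.range ρ' = insert v (Set.range ρ) := by
      rw [hρ', Finset.range_orderEmbOfFin]
      simp
    obtain ⟨i, hi⟩ : v ∈ Set.range ρ' := hr ▸ Set.mem_insert _ _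
    refine ⟨(ρ', i), by simp, ?_⟩
    simp only [hi, Prod.mk.injEq, and_true]
    rw [← OrderEmbedding.range_inj]
    have h2 := hrange ρ' i
    rw [hr, hi] at h2
    have hv' : v ∉ Set.range ((Fin.succAboveOrderEmb i).trans ρ') := by
      rintro ⟨j, hj⟩
      exact Fin.succAbove_ne i j (ρ'.injective (hj.trans hi.symm))
    rw [← Set.insert_sdiff_self_of_notMem hv', ← h2, Set.insert_sdiff_self_of_notMem hv]

/-- The Lefschetz number of an augmented chain endomorphism of a simplex vanishes: if all the
diagonal coefficients outside of degree `-1` are zero, so is the one in degree `-1`. Here `F ρ κ`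
is the coefficient of the oriented simplex `κ` in the image of the simplex `ρ`. -/
theorem augmentation_eq_zero_of_forall_diagonal_eq_zero {M : Type*} [AddCommGroup M] {m : ℕ}
    (F : ∀ n, (Fin n → Fin (m + 1)) → (Fin n → Fin (m + 1)) → M)
    (hperm : ∀ n ρ κ (σ : Equiv.Perm (Fin n)),
      F n ρ (κ ∘ σ) = (Equiv.Perm.sign σ : ℤ) • F n ρ κ)
    (hinj : ∀ n ρ κ, ¬ Function.Injective κ → F n ρ κ = 0)
    (hd : ∀ n (ρ : Fin (n + 1) → Fin (m + 1)) (κ : Fin n → Fin (m + 1)), StrictMono ρ →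
      ∑ v, F (n + 1) ρ (Fin.cons v κ : Fin (n + 1) → Fin (m + 1)) =
        ∑ i : Fin (n + 1), (-1 : ℤ) ^ (i : ℕ) • F n (ρ ∘ i.succAbove) κ)
    (hdiag : ∀ n (ρ : Fin (n + 1) → Fin (m + 1)), StrictMono ρ → F (n + 1) ρ ρ = 0)
    (ρ₀ : Fin 0 → Fin (m + 1)) : F 0 ρ₀ ρ₀ = 0 := by
  let c (n : ℕ) (v : Fin (m + 1)) (ρ : Fin n → Fin m) : Fin (n + 1) → Fin (m + 1) :=
    Fin.cons v (Fin.succ ∘ ρ)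
  -- The cone with apex `0` contracts the simplex, and `Z n` collects the off-diagonal terms which
  -- this contraction produces from the faces `ρ` avoiding `0`. They telescope: `Z 0` is the
  -- coefficient sought, `Z n = -Z (n + 1)`, and `Z (m + 1)` is an empty sum.
  let Z (n : ℕ) : M := ∑ ρ : Fin n ↪o Fin m, ∑ v : Fin m, F (n + 1) (c n 0 ρ) (c n v.succ ρ)
  have hmono (n : ℕ) (ρ : Fin n ↪o Fin m) : StrictMono (c n 0 ρ) := by
    intro a b hab
    cases b using Fin.cases with
    | zero => simp at hab
    | succ b =>
      cases a using Fin.cases with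
      | zero => simp [c]
      | succ a => simpa [c] using hab
  have key (n : ℕ) (ρ : Fin n ↪o Fin m) :
      ∑ v : Fin m, F (n + 1) (c n 0 ρ) (c n v.succ ρ) = F n (Fin.succ ∘ ρ) (Fin.succ ∘ ρ) +
        ∑ i : Fin n, (-1 : ℤ) ^ ((i : ℕ) + 1) • F n (c n 0 ρ ∘ i.succ.succAbove)
          (Fin.succ ∘ ρ) := by
    -- In the chain map identity for the cone `0ρ`, the term `v = 0` is diagonal and drops out,
    -- while deleting the apex gives the diagonal term of `ρ`.
    have h := hd n (c n 0 ρ) (Fin.succ ∘ ρ) (hmono n ρ)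
    rw [Fin.sum_univ_succ, Fin.sum_univ_succ] at h
    rw [show (Fin.cons 0 (Fin.succ ∘ ρ) : Fin (n + 1) → Fin (m + 1)) = c n 0 ρ from rfl,
      hdiag n _ (hmono n ρ), zero_add, cons_comp_succAbove_zero] at h
    simpa using h
  have hzero : Z 0 = F 0 ρ₀ ρ₀ := by
    have : Subsingleton (Fin 0 ↪o Fin m) := ⟨fun a b => by ext i; exact i.elim0⟩
    have : Unique (Fin 0 ↪o Fin m) := uniqueOfSubsingleton (OrderEmbedding.ofIsEmpty)
    simp only [Z, key]
    simp [Subsingleton.elim _ ρ₀]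
  have hstep (n : ℕ) : Z n = - Z (n + 1) := by
    have h1 : Z n = ∑ ρ : Fin (n + 1) ↪o Fin m, ∑ i : Fin (n + 1), (-1 : ℤ) ^ (i : ℕ) •
        F (n + 1) (c n 0 (ρ ∘ i.succAbove)) (Fin.succ ∘ ρ) := by
      refine (sum_orderEmbedding_insert
        (fun ρ v => F (n + 1) (c n 0 ρ) (c n v.succ ρ)) ?_).trans ?_
      · rintro ρ _ ⟨i, rfl⟩
        refine hinj _ _ _ fun h => ?_
        exact (Fin.succ_ne_zero i) (h (a₁ := i.succ) (a₂ := 0) (by simp [c]))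
      · refine Finset.sum_congr rfl fun ρ _ => Finset.sum_congr rfl fun i _ => ?_
        -- Moving the entry at position `i` to the front is a cycle of sign `(-1) ^ i`.
        have : c n (ρ i).succ ((Fin.succAboveOrderEmb i).trans ρ) =
            (Fin.succ ∘ ρ) ∘ i.cycleRange.symm :=
          Fin.cons_removeNth_eq_comp_cycleRange_symm (Fin.succ ∘ ρ) i
        rw [this, hperm, Equiv.Perm.sign_symm, Fin.sign_cycleRange]
        simp
        rfl
    rw [h1, eq_neg_iff_add_eq_zero, ← Finset.sum_add_distrib]
    refine Finset.sum_eq_zero fun ρ _ => ?_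
    rw [key, hdiag n _ ((Fin.strictMono_succ).comp ρ.strictMono), zero_add,
      ← Finset.sum_add_distrib]
    refine Finset.sum_eq_zero fun i _ => ?_
    rw [cons_comp_succAbove_succ, pow_succ, mul_neg_one, neg_smul]
    exact add_neg_cancel _
  have hZ (n : ℕ) : Z 0 = (-1 : ℤ) ^ n • Z n := by
    induction n with
    | zero => simp
    | succ n ih => rw [ih, hstep n, pow_succ, mul_neg_one, neg_smul, smul_neg]
  have hempty : IsEmpty (Fin (m + 1) ↪o Fin m) :=
    ⟨fun ρ => by simpa using Fintype.card_le_of_injective ρ ρ.injective⟩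
  rw [← hzero, hZ (m + 1)]
  simp [Z]

/-! ### Finitely supported singular chains -/

/-- A face of a singular simplex, a simplex with `n` vertices being a map from
`stdSimplex ℝ (Fin n)`. -/
noncomputable def singularFace {X : Type*} [TopologicalSpace X] {n : ℕ}
    (s : C(stdSimplex ℝ (Fin (n + 1)), X)) (i : Fin (n + 1)) : C(stdSimplex ℝ (Fin n), X) :=
  s.comp ⟨stdSimplex.map i.succAbove, stdSimplex.continuous_map _⟩

/-- The boundary operator on finitely supported singular chains, augmented by the unique simplex
without vertices. -/
noncomputable def singularBoundary (G : Type*) [AddCommGroup G] (X : Type*) [TopologicalSpace X]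
    (n : ℕ) : (C(stdSimplex ℝ (Fin (n + 1)), X) →₀ G) →+ (C(stdSimplex ℝ (Fin n), X) →₀ G) :=
  Finsupp.liftAddHom fun s =>
    ∑ i : Fin (n + 1), (-1 : ℤ) ^ (i : ℕ) • Finsupp.singleAddHom (singularFace s i)

theorem singularBoundary_single {G : Type*} [AddCommGroup G] {X : Type*} [TopologicalSpace X]
    {n : ℕ} (s : C(stdSimplex ℝ (Fin (n + 1)), X)) (g : G) :
    singularBoundary G X n (Finsupp.single s g) =
      ∑ i : Fin (n + 1), (-1 : ℤ) ^ (i : ℕ) • Finsupp.single (singularFace s i) g := by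
  simp [singularBoundary]

instance isEmpty_stdSimplex_fin_zero : IsEmpty (stdSimplex ℝ (Fin 0)) :=
  Set.isEmpty_coe_sort.2 (stdSimplex_of_isEmpty_index ℝ (Fin 0))

/-- The unique singular simplex without vertices. -/
noncomputable instance uniqueSingularSimplexFinZero (X : Type*) [TopologicalSpace X] :
    Unique C(stdSimplex ℝ (Fin 0), X) where
  default := ⟨isEmptyElim, continuous_of_discreteTopology⟩
  uniq _ := ContinuousMap.ext isEmptyElim

/-! ### Comparison with the categorical singular complex -/

section Comparison

open Simplicial

variable (G : Type u) [AddCommGroup G] (U : Type u) [TopologicalSpace U]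

/-- Mathlib's singular chain complex. -/
noncomputable abbrev categoricalSingularComplex : ChainComplex AddCommGrpCat.{u} ℕ :=
  (TopCat.toSSet.obj (TopCat.of U)).chainComplex (AddCommGrpCat.of G)

/-- Simplices of the singular simplicial set are continuous maps. -/
noncomputable def singularSimplexEquiv (n : ℕ) :
    (TopCat.toSSet.obj (TopCat.of U)) _⦋n⦌ ≃ C(stdSimplex ℝ (Fin (n + 1)), U) :=
  (TopCat.of U).toSSetObjEquiv (.op ⦋n⦌)

theorem singularSimplexEquiv_δ {n : ℕ} (x : (TopCat.toSSet.obj (TopCat.of U)) _⦋n + 1⦌)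
    (i : Fin (n + 2)) :
    singularSimplexEquiv U n ((TopCat.toSSet.obj (TopCat.of U)).δ i x) =
      singularFace (singularSimplexEquiv U (n + 1) x) i := by
  ext z
  exact TopCat.toSSetObjEquiv_δ_apply x i z

/-- The comparison from finitely supported chains to Mathlib's singular chains. -/
noncomputable def chainToCategorical (n : ℕ) :
    (C(stdSimplex ℝ (Fin (n + 1)), U) →₀ G) →+ (categoricalSingularComplex G U).X n :=
  Finsupp.liftAddHom fun s => ((TopCat.toSSet.obj (TopCat.of U)).ιChainComplex
    (R := AddCommGrpCat.of G) ((singularSimplexEquiv U n).symm s)).hom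

/-- The comparison from Mathlib's singular chains to finitely supported chains. -/
noncomputable def chainOfCategorical (n : ℕ) : (categoricalSingularComplex G U).X n ⟶
    AddCommGrpCat.of (C(stdSimplex ℝ (Fin (n + 1)), U) →₀ G) :=
  ((TopCat.toSSet.obj (TopCat.of U)).isColimitChainComplexXCofan (AddCommGrpCat.of G) n).desc
    (Cofan.mk _ fun x => AddCommGrpCat.ofHom (Finsupp.singleAddHom (singularSimplexEquiv U n x)))

theorem ι_chainOfCategorical {n : ℕ} (x : (TopCat.toSSet.obj (TopCat.of U)) _⦋n⦌) :
    (TopCat.toSSet.obj (TopCat.of U)).ιChainComplex x ≫ chainOfCategorical G U n =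
      AddCommGrpCat.ofHom (Finsupp.singleAddHom (singularSimplexEquiv U n x)) :=
  ((TopCat.toSSet.obj (TopCat.of U)).isColimitChainComplexXCofan (AddCommGrpCat.of G) n).fac _ ⟨x⟩

theorem chainOfCategorical_chainToCategorical {n : ℕ}
    (c : C(stdSimplex ℝ (Fin (n + 1)), U) →₀ G) :
    (chainOfCategorical G U n).hom (chainToCategorical G U n c) = c := by
  suffices H : (chainOfCategorical G U n).hom.comp (chainToCategorical G U n) = AddMonoidHom.id _
    from DFunLike.congr_fun H c
  refine Finsupp.addHom_ext fun s g => ?_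
  have h := ConcreteCategory.congr_hom
    (ι_chainOfCategorical G U ((singularSimplexEquiv U n).symm s)) g
  simpa [chainToCategorical] using h

theorem chainToCategorical_chainOfCategorical {n : ℕ} (c : (categoricalSingularComplex G U).X n) :
    chainToCategorical G U n ((chainOfCategorical G U n).hom c) = c := by
  suffices H : chainOfCategorical G U n ≫ AddCommGrpCat.ofHom (chainToCategorical G U n) = 𝟙 _
    from ConcreteCategory.congr_hom H c
  refine SSet.chainComplex_hom_ext fun x => ?_
  rw [← Category.assoc, ι_chainOfCategorical]
  ext g
  simp [chainToCategorical]

theorem chainOfCategorical_d {n : ℕ} (c : (categoricalSingularComplex G U).X (n + 1)) :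
    (chainOfCategorical G U n).hom ((categoricalSingularComplex G U).d (n + 1) n c) =
      singularBoundary G U (n + 1) ((chainOfCategorical G U (n + 1)).hom c) := by
  suffices H : (categoricalSingularComplex G U).d (n + 1) n ≫ chainOfCategorical G U n =
      chainOfCategorical G U (n + 1) ≫ AddCommGrpCat.ofHom (singularBoundary G U (n + 1)) from
    ConcreteCategory.congr_hom H c
  refine SSet.chainComplex_hom_ext fun x => ?_
  rw [← Category.assoc, ← Category.assoc, ι_chainOfCategorical, SSet.ιChainComplex_d,
    Preadditive.sum_comp]
  simp_rw [Preadditive.zsmul_comp, ι_chainOfCategorical, singularSimplexEquiv_δ]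
  refine AddCommGrpCat.hom_ext ((map_sum AddCommGrpCat.homAddEquiv _ _).trans ?_)
  ext g : 1
  simp only [AddMonoidHom.finsetSum_apply, map_zsmul, AddMonoidHom.smul_apply, singularBoundary,
    AddCommGrpCat.hom_comp, AddCommGrpCat.hom_ofHom, AddMonoidHom.comp_apply,
    Finsupp.singleAddHom_apply, Finsupp.liftAddHom_apply_single]
  rfl

/-- Cycles are boundaries as soon as they are so in Mathlib's singular complex. -/
theorem exists_singularBoundary_eq_of_categorical {n : ℕ} (z : C(stdSimplex ℝ (Fin (n + 1)), U) →₀ G)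
    (h : ∃ c, (categoricalSingularComplex G U).d (n + 1) n c = chainToCategorical G U n z) :
    ∃ c, singularBoundary G U (n + 1) c = z := by
  obtain ⟨c, hc⟩ := h
  refine ⟨(chainOfCategorical G U (n + 1)).hom c, ?_⟩
  rw [← chainOfCategorical_d, hc, chainOfCategorical_chainToCategorical]

theorem exists_singularBoundary_eq_of_subsingleton_succ (n : ℕ)
    (h : Subsingleton (reducedSingularHomology G U ((n + 1 : ℕ) : ℤ)))
    (z : C(stdSimplex ℝ (Fin (n + 2)), U) →₀ G) (hz : singularBoundary G U (n + 1) z = 0) :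
    ∃ c, singularBoundary G U (n + 2) c = z := by
  refine exists_singularBoundary_eq_of_categorical G U z ?_
  have h0 : IsZero ((categoricalSingularComplex G U).homology (n + 1)) :=
    AddCommGrpCat.isZero_iff_subsingleton.2 h
  rw [← HomologicalComplex.exactAt_iff_isZero_homology,
    HomologicalComplex.exactAt_iff' _ (n + 2) (n + 1) n (by simp) (by simp),
    ShortComplex.ab_exact_iff] at h0
  refine h0 _ ?_
  change (categoricalSingularComplex G U).d (n + 1) n _ = 0
  rw [← chainToCategorical_chainOfCategorical G U
    ((categoricalSingularComplex G U).d (n + 1) n _), chainOfCategorical_d,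
    chainOfCategorical_chainToCategorical, hz, map_zero]

theorem exists_singularBoundary_eq_of_subsingleton_zero
    (h : Subsingleton (reducedSingularHomology G U 0))
    (z : C(stdSimplex ℝ (Fin 1), U) →₀ G) (hz : singularBoundary G U 0 z = 0) :
    ∃ c, singularBoundary G U 1 c = z := by
  refine exists_singularBoundary_eq_of_categorical G U z ?_
  let S := TopCat.toSSet.obj (TopCat.of U)
  let R := AddCommGrpCat.of G
  have h0 : IsZero (kernel (S.homology₀ε R)) := AddCommGrpCat.isZero_iff_subsingleton.2 h
  have hε : Mono (S.homology₀ε R) := Preadditive.mono_of_isZero_kernel _ h0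
  -- Under the identification of `H₀` with a coproduct over path components, `a` is the
  -- augmentation, so it is injective when reduced `H₀` vanishes.
  let a : (∐ fun _ : S.π₀ => R) ⟶ R := Sigma.desc fun _ => 𝟙 R
  have ha : Mono a := by
    have : a = (S.homology₀Iso R).inv ≫ S.homology₀ε R := by simp [SSet.homology₀ε, a]
    rw [this]
    infer_instance
  -- The coproduct over `π₀` is the cokernel of `d : C₁ ⟶ C₀`, so a `0`-chain with zero image in it
  -- is a boundary; by injectivity of `a`, zero augmentation suffices.
  have hex := ShortComplex.exact_of_g_is_cokernel
    (ShortComplex.mk _ _ (SSet.π₀.d_fromChainComplexXZero S R 1))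
    (S.isColimitCokernelCoforkChainComplexDOneZero R)
  rw [ShortComplex.ab_exact_iff] at hex
  refine hex _ ?_
  refine (AddCommGrpCat.mono_iff_injective a).1 ha ?_
  have key : ((SSet.π₀.fromChainComplexXZero S R ≫ a).hom.comp (chainToCategorical G U 0)) =
      (Finsupp.applyAddHom default).comp (singularBoundary G U 0) := by
    refine Finsupp.addHom_ext fun s g => ?_
    have : S.ιChainComplex ((singularSimplexEquiv U 0).symm s) ≫
        (SSet.π₀.fromChainComplexXZero S R ≫ a) = 𝟙 R := by simp [a]
    have h2 := ConcreteCategory.congr_hom this g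
    have h3 : singularFace s 0 = default := Subsingleton.elim _ _
    rw [AddMonoidHom.comp_apply, chainToCategorical, Finsupp.liftAddHom_apply_single]
    exact h2.trans (by simp [singularBoundary, h3])
  have h3 := DFunLike.congr_fun key z
  simp only [AddMonoidHom.comp_apply, hz, map_zero] at h3
  rw [map_zero]
  exact h3

end Comparison

/-! ### Functoriality and filling inside a subset -/

/-- The chain map induced by a continuous map. -/
noncomputable def singularChainMap (G : Type*) [AddCommGroup G] {X Y : Type*} [TopologicalSpace X]
    [TopologicalSpace Y] (f : C(X, Y)) (n : ℕ) :
    (C(stdSimplex ℝ (Fin n), X) →₀ G) →+ (C(stdSimplex ℝ (Fin n), Y) →₀ G) :=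
  Finsupp.mapDomain.addMonoidHom f.comp

theorem singularBoundary_singularChainMap {G : Type*} [AddCommGroup G] {X Y : Type*}
    [TopologicalSpace X] [TopologicalSpace Y] (f : C(X, Y)) (n : ℕ)
    (c : C(stdSimplex ℝ (Fin (n + 1)), X) →₀ G) :
    singularBoundary G Y n (singularChainMap G f (n + 1) c) =
      singularChainMap G f n (singularBoundary G X n c) := by
  suffices H : (singularBoundary G Y n).comp (singularChainMap G f (n + 1)) =
      (singularChainMap G f n).comp (singularBoundary G X n) from DFunLike.congr_fun H c
  refine Finsupp.addHom_ext fun s g => ?_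
  simp only [AddMonoidHom.comp_apply, singularBoundary_single, map_sum, map_zsmul, singularChainMap,
    Finsupp.mapDomain.addMonoidHom_apply, Finsupp.mapDomain_single]
  rfl

/-- A cycle supported in a subset with vanishing reduced homology bounds in that subset. -/
theorem exists_singularBoundary_eq_of_range_subset {X : Type u} [TopologicalSpace X] (G : Type u)
    [AddCommGroup G] (U : Set X) (n : ℕ)
    (h : Subsingleton (reducedSingularHomology G U (n : ℤ)))
    (z : C(stdSimplex ℝ (Fin (n + 1)), X) →₀ G) (hz : singularBoundary G X n z = 0)
    (hzU : ∀ s ∈ z.support, Set.range s ⊆ U) :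
    ∃ c, singularBoundary G X (n + 1) c = z ∧ ∀ s ∈ c.support, Set.range s ⊆ U := by
  let ι : C(U, X) := ⟨Subtype.val, continuous_subtype_val⟩
  have hι (k : ℕ) : Function.Injective (ι.comp : C(stdSimplex ℝ (Fin k), U) → _) := by
    intro s t hst
    ext x
    exact congrArg (fun f : C(stdSimplex ℝ (Fin k), X) => f x) hst
  obtain ⟨z', rfl⟩ : ∃ z', singularChainMap G ι (n + 1) z' = z := by
    refine ⟨z.comapDomain _ (hι _).injOn, Finsupp.mapDomain_comapDomain _ (hι _) _ fun s hs => ?_⟩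
    exact ⟨⟨fun x => ⟨s x, hzU s hs ⟨x, rfl⟩⟩, by fun_prop⟩, by ext; rfl⟩
  have hz' : singularBoundary G U n z' = 0 := by
    rw [singularBoundary_singularChainMap] at hz
    exact Finsupp.mapDomain_injective (hι n) (hz.trans Finsupp.mapDomain_zero.symm)
  obtain ⟨c, rfl⟩ : ∃ c, singularBoundary G U (n + 1) c = z' := by
    cases n with
    | zero => exact exists_singularBoundary_eq_of_subsingleton_zero G U h z' hz'
    | succ n => exact exists_singularBoundary_eq_of_subsingleton_succ G U n h z' hz'
  refine ⟨singularChainMap G ι (n + 2) c, singularBoundary_singularChainMap ι _ c, fun s hs => ?_⟩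
  classical
  obtain ⟨t, -, rfl⟩ := Finset.mem_image.1 (Finsupp.mapDomain_support hs)
  rintro _ ⟨x, rfl⟩
  exact (t x).2

/-! ### Mesh of iterated subdivisions -/

section Mesh

variable {P : Type*} [PseudoMetricSpace P] {β : ∀ n, (Fin (n + 1) → P) → P}

theorem exists_of_mem_support_tupleSubdivision {P : Type*} {β : ∀ n, (Fin (n + 1) → P) → P} {n : ℕ}
    {τ τ' : Fin (n + 1) → P} (h : τ' ∈ (tupleSubdivision β (n + 1) τ).support) :
    ∃ i : Fin (n + 1), ∃ τ'' ∈ (tupleSubdivision β n (τ ∘ i.succAbove)).support,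
      τ' = (Fin.cons (β n τ) τ'' : Fin (n + 1) → P) := by
  classical
  obtain ⟨τ'', hτ'', rfl⟩ := Finset.mem_image.1 (Finsupp.mapDomain_support
    (s := ∑ i : Fin (n + 1), (-1 : ℤ) ^ (i : ℕ) • tupleSubdivision β n (τ ∘ i.succAbove)) h)
  obtain ⟨i, -, hi⟩ := Finsupp.mem_support_finsetSum τ'' hτ''
  exact ⟨i, τ'', Finsupp.support_smul hi, rfl⟩

/-- Closed balls containing a tuple contain its subdivision. The only property of barycenters needed
is `hβ`, a convexity inequality for the distance. -/
theorem dist_le_of_mem_support_tupleSubdivision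
    (hβ : ∀ n τ x, dist (β n τ) x ≤ (n + 1 : ℝ)⁻¹ * ∑ i, dist (τ i) x) {n : ℕ} {τ τ' : Fin n → P}
    (h : τ' ∈ (tupleSubdivision β n τ).support) {x : P} {r : ℝ} (hr : ∀ i, dist (τ i) x ≤ r)
    (a : Fin n) : dist (τ' a) x ≤ r := by
  induction n with
  | zero => exact a.elim0
  | succ n ih =>
    obtain ⟨i, τ'', hτ'', rfl⟩ := exists_of_mem_support_tupleSubdivision h
    cases a using Fin.cases with
    | zero =>
      refine (hβ n τ x).trans ?_
      rw [inv_mul_le_iff₀ (by positivity)]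
      refine (Finset.sum_le_card_nsmul _ _ r fun i _ => hr i).trans_eq ?_
      simp
    | succ a => exact ih hτ'' (fun j => hr _) a

/-- The barycenter of `n + 1` points is within `n / (n + 1) * d` of each of them, since one of the
averaged distances is zero. Pairs not involving the apex lie in the subdivision of a face. A common
`N` keeps the ratio uniform in this recursion. -/
theorem dist_pairwise_le_of_mem_support_tupleSubdivision
    (hβ : ∀ n τ x, dist (β n τ) x ≤ (n + 1 : ℝ)⁻¹ * ∑ i, dist (τ i) x) {N n : ℕ} (hn : n ≤ N + 1)
    {τ τ' : Fin n → P} (h : τ' ∈ (tupleSubdivision β n τ).support) {d : ℝ}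
    (hd : ∀ i j, dist (τ i) (τ j) ≤ d) (a b : Fin n) :
    dist (τ' a) (τ' b) ≤ (N / (N + 1) : ℝ) * d := by
  induction n with
  | zero => exact a.elim0
  | succ n ih =>
    have hd0 : 0 ≤ d := dist_nonneg.trans (hd 0 0)
    obtain ⟨i, τ'', hτ'', rfl⟩ := exists_of_mem_support_tupleSubdivision h
    have hapex (j : Fin (n + 1)) : dist (τ j) (β n τ) ≤ (N / (N + 1) : ℝ) * d := by
      rw [dist_comm]
      refine (hβ n τ _).trans ?_
      rw [Fin.sum_univ_succAbove _ j, dist_self, zero_add]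
      have h1 : ∑ i : Fin n, dist (τ (j.succAbove i)) (τ j) ≤ n * d :=
        (Finset.sum_le_card_nsmul _ _ d fun i _ => hd _ _).trans_eq (by simp)
      have h2 : (n : ℝ) ≤ N := by exact_mod_cast Nat.le_of_succ_le_succ hn
      calc (n + 1 : ℝ)⁻¹ * ∑ i : Fin n, dist (τ (j.succAbove i)) (τ j)
          ≤ (n + 1 : ℝ)⁻¹ * (n * d) := by gcongr
        _ = (n / (n + 1) : ℝ) * d := by ring
        _ ≤ (N / (N + 1) : ℝ) * d := by
          gcongr ?_ * d
          rw [div_le_div_iff₀ (by positivity) (by positivity)]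
          linarith
    -- The ball around the apex contains the vertices of the face, hence those of its subdivision.
    have hapex' (a : Fin n) : dist (τ'' a) (β n τ) ≤ (N / (N + 1) : ℝ) * d :=
      dist_le_of_mem_support_tupleSubdivision hβ hτ'' (fun j => hapex _) a
    cases a using Fin.cases with
    | zero =>
      cases b using Fin.cases with
      | zero => simpa using mul_nonneg (by positivity) hd0
      | succ b => simpa [dist_comm] using hapex' b
    | succ a =>
      cases b using Fin.cases with
      | zero => simpa using hapex' a
      | succ b => simpa using ih (by omega) hτ'' (fun i j => hd _ _) a b

theorem dist_pairwise_le_of_mem_support_iterate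
    (hβ : ∀ n τ x, dist (β n τ) x ≤ (n + 1 : ℝ)⁻¹ * ∑ i, dist (τ i) x) {n : ℕ} {d : ℝ}
    {c : (Fin n → P) →₀ ℤ} (hd : ∀ τ ∈ c.support, ∀ i j, dist (τ i) (τ j) ≤ d) (k : ℕ) :
    ∀ τ ∈ ((chainSubdivision β n)^[k] c).support, ∀ i j,
      dist (τ i) (τ j) ≤ (n / (n + 1) : ℝ) ^ k * d := by
  classical
  induction k with
  | zero => simpa using hd
  | succ k ih =>
    intro τ hτ i j
    rw [Function.iterate_succ_apply', chainSubdivision, Finsupp.linearCombination_apply] at hτ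
    obtain ⟨σ, hσ, hτσ⟩ := Finset.mem_biUnion.1 (Finsupp.support_sum hτ)
    rw [pow_succ', mul_assoc]
    -- Taking `N = n` is not sharp for `n` vertices, but any fixed ratio below `1` suffices.
    exact dist_pairwise_le_of_mem_support_tupleSubdivision hβ (Nat.le_succ n)
      (Finsupp.support_smul hτσ) (ih σ hσ) i j

end Mesh

/-! ### Subdivision of the standard simplex -/

/-- The barycenter of a tuple of points of a standard simplex. -/
noncomputable def stdSimplexAverage (ι : Type*) [Fintype ι] (n : ℕ)
    (v : Fin (n + 1) → stdSimplex ℝ ι) : stdSimplex ℝ ι :=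
  ⟨∑ i, (n + 1 : ℝ)⁻¹ • (v i : ι → ℝ), (convex_stdSimplex ℝ ι).sum_mem (fun _ _ => by positivity)
    (by simp [field]) fun i _ => (v i).2⟩

theorem dist_stdSimplexAverage_le (ι : Type*) [Fintype ι] (n : ℕ)
    (v : Fin (n + 1) → stdSimplex ℝ ι) (x : stdSimplex ℝ ι) :
    dist (stdSimplexAverage ι n v) x ≤ (n + 1 : ℝ)⁻¹ * ∑ i, dist (v i) x := by
  have h : (stdSimplexAverage ι n v).1 - x.1 = ∑ i, (n + 1 : ℝ)⁻¹ • ((v i).1 - x.1) := by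
    have h1 : ∑ _i : Fin (n + 1), (n + 1 : ℝ)⁻¹ • x.1 = x.1 := by
      have h2 : ((n : ℝ) + 1) * ((n : ℝ) + 1)⁻¹ = 1 := mul_inv_cancel₀ (by positivity)
      rw [← Finset.sum_smul]
      simp [h2]
    simp only [smul_sub, Finset.sum_sub_distrib, h1]
    rfl
  rw [Subtype.dist_eq, dist_eq_norm, h, Finset.mul_sum]
  refine (norm_sum_le _ _).trans (Finset.sum_le_sum fun i _ => ?_)
  rw [norm_smul, Subtype.dist_eq, dist_eq_norm, Real.norm_of_nonneg (by positivity)]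

theorem map_stdSimplexAverage {ι κ : Type*} [Fintype ι] [Fintype κ] (f : ι → κ) (n : ℕ)
    (v : Fin (n + 1) → stdSimplex ℝ ι) : stdSimplex.map f (stdSimplexAverage ι n v) =
      stdSimplexAverage κ n (stdSimplex.map f ∘ v) := by
  refine stdSimplex.ext ?_
  change FunOnFinite.linearMap ℝ ℝ f (∑ i, (n + 1 : ℝ)⁻¹ • (v i : ι → ℝ)) =
    ∑ i, (n + 1 : ℝ)⁻¹ • FunOnFinite.linearMap ℝ ℝ f (v i : ι → ℝ)
  simp

/-- The `k`-fold barycentric subdivision of the standard simplex with `n` vertices. -/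
noncomputable def subdividedSimplex (n k : ℕ) : (Fin n → stdSimplex ℝ (Fin n)) →₀ ℤ :=
  (chainSubdivision (stdSimplexAverage (Fin n)) n)^[k]
    (Finsupp.single (fun i => stdSimplex.vertex i) 1)

/-- Subdivision commutes with the boundary, and with face inclusions because these preserve
barycenters. -/
theorem tupleBoundary_subdividedSimplex (n k : ℕ) :
    tupleBoundary _ n (subdividedSimplex (n + 1) k) = ∑ i : Fin (n + 1), (-1 : ℤ) ^ (i : ℕ) •
      tupleMap (stdSimplex.map i.succAbove) n (subdividedSimplex n k) := by
  rw [subdividedSimplex, tupleBoundary_iterate_chainSubdivision, tupleBoundary_single]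
  rw [← Module.End.pow_apply, map_sum]
  refine Finset.sum_congr rfl fun i _ => ?_
  rw [map_smul, Module.End.pow_apply, subdividedSimplex,
    tupleMap_iterate_chainSubdivision (fun m => map_stdSimplexAverage (i.succAbove) m),
    tupleMap_single]
  congr 3
  ext1 j
  simp

/-- Lebesgue's number lemma for the preimages of the `A j`, combined with the mesh tending to zero.
Only the vertices of the small simplices are controlled, and only they carry labels. -/
theorem exists_forall_mem_support_subdividedSimplex {X : Type*} [TopologicalSpace X] {n : ℕ}
    {J : Type*} (A : J → Set X) (hA : ∀ j, IsOpen (A j)) (s : C(stdSimplex ℝ (Fin (n + 1)), X))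
    (hs : Set.range s ⊆ ⋃ j, A j) :
    ∀ᶠ k in Filter.atTop, ∀ τ ∈ (subdividedSimplex (n + 1) k).support, ∃ j, ∀ a, s (τ a) ∈ A j := by
  obtain ⟨δ, hδ, hball⟩ := lebesgue_number_lemma_of_metric
    (isCompact_univ (X := stdSimplex ℝ (Fin (n + 1)))) (fun j => (hA j).preimage s.continuous)
    (fun x _ => by simpa using hs ⟨x, rfl⟩)
  have hlim : Filter.Tendsto (fun k : ℕ => (((n + 1 : ℕ) : ℝ) / ((n + 1 : ℕ) + 1)) ^ k *
      Metric.diam (Set.univ : Set (stdSimplex ℝ (Fin (n + 1))))) Filter.atTop (nhds 0) := by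
    rw [← zero_mul (Metric.diam (Set.univ : Set (stdSimplex ℝ (Fin (n + 1)))))]
    refine (tendsto_pow_atTop_nhds_zero_of_lt_one (by positivity) ?_).mul_const _
    rw [div_lt_one (by positivity)]
    exact lt_add_one _
  filter_upwards [hlim.eventually (gt_mem_nhds hδ)] with k hk τ hτ
  obtain ⟨j, hj⟩ := hball (τ 0) (Set.mem_univ _)
  refine ⟨j, fun a => hj ?_⟩
  refine (dist_pairwise_le_of_mem_support_iterate (dist_stdSimplexAverage_le _) (fun τ _ i j =>
    Metric.dist_le_diam_of_mem isCompact_univ.isBounded (Set.mem_univ _) (Set.mem_univ _)) k τ hτ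
      a 0).trans_lt hk

/-! ### Counting labelled simplices in subdivisions -/

section Count

variable {X V : Type*} [TopologicalSpace X] [DecidableEq V] (l : X → V) (k : ℕ)

/-- The number of simplices in the `k`-fold subdivision of `s` whose vertices are labelled by `κ`,
counted with orientation. -/
noncomputable def simplexCount {n : ℕ} (κ : Fin n → V) (s : C(stdSimplex ℝ (Fin n), X)) : ℤ :=
  tuplePairing κ (tupleMap (l ∘ s) n (subdividedSimplex n k))

theorem sum_simplexCount_cons [Fintype V] {n : ℕ} (κ : Fin n → V)
    (s : C(stdSimplex ℝ (Fin (n + 1)), X)) :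
    ∑ v, simplexCount l k (Fin.cons v κ : Fin (n + 1) → V) s =
      ∑ i : Fin (n + 1), (-1 : ℤ) ^ (i : ℕ) * simplexCount l k κ (singularFace s i) := by
  simp only [simplexCount]
  rw [sum_tuplePairing_cons, ← tupleMap_tupleBoundary, tupleBoundary_subdividedSimplex]
  simp only [map_sum, map_smul, tupleMap_tupleMap, smul_eq_mul]
  rfl

/-- A small simplex with vertices in `A (κ b)` has no vertex labelled `κ b`, so its determinant has
a zero column. -/
theorem eventually_simplexCount_eq_zero {n : ℕ} (A : V → Set X) (hA : ∀ v, IsOpen (A v))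
    (hl : ∀ x, x ∉ A (l x)) (κ : Fin (n + 1) → V) (s : C(stdSimplex ℝ (Fin (n + 1)), X))
    (hs : Set.range s ⊆ ⋃ a, A (κ a)) : ∀ᶠ k in Filter.atTop, simplexCount l k κ s = 0 := by
  filter_upwards [exists_forall_mem_support_subdividedSimplex (fun a => A (κ a))
    (fun a => hA (κ a)) s hs] with k hk
  refine tuplePairing_eq_zero_of_forall_exists fun τ hτ => ?_
  classical
  obtain ⟨σ, hσ, rfl⟩ := Finset.mem_image.1 (Finsupp.mapDomain_support hτ)
  obtain ⟨b, hb⟩ := hk σ hσ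
  refine ⟨b, fun a h => hl (s (σ a)) ?_⟩
  rw [show l (s (σ a)) = κ b from h]
  exact hb a

/-- The extension of `simplexCount` to chains. -/
noncomputable def chainCount (G : Type*) [AddCommGroup G] {n : ℕ} (κ : Fin n → V) :
    (C(stdSimplex ℝ (Fin n), X) →₀ G) →+ G :=
  Finsupp.liftAddHom fun s => simplexCount l k κ s • AddMonoidHom.id G

theorem sum_chainCount_cons {G : Type*} [AddCommGroup G] [Fintype V] {n : ℕ} (κ : Fin n → V)
    (c : C(stdSimplex ℝ (Fin (n + 1)), X) →₀ G) :
    ∑ v, chainCount l k G (Fin.cons v κ : Fin (n + 1) → V) c =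
      chainCount l k G κ (singularBoundary G X n c) := by
  suffices H : ∑ v, chainCount l k G (Fin.cons v κ : Fin (n + 1) → V) =
      (chainCount l k G κ).comp (singularBoundary G X n) by simpa using DFunLike.congr_fun H c
  refine Finsupp.addHom_ext fun s g => ?_
  simp only [AddMonoidHom.finsetSum_apply, chainCount, Finsupp.liftAddHom_apply_single,
    AddMonoidHom.smul_apply, AddMonoidHom.id_apply, AddMonoidHom.comp_apply,
    singularBoundary_single, map_sum, map_zsmul, smul_smul]
  rw [← Finset.sum_smul, ← Finset.sum_smul, sum_simplexCount_cons]

theorem eventually_chainCount_eq_zero {G : Type*} [AddCommGroup G] {n : ℕ} (A : V → Set X)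
    (hA : ∀ v, IsOpen (A v)) (hl : ∀ x, x ∉ A (l x)) (κ : Fin (n + 1) → V)
    (c : C(stdSimplex ℝ (Fin (n + 1)), X) →₀ G)
    (hc : ∀ s ∈ c.support, Set.range s ⊆ ⋃ a, A (κ a)) :
    ∀ᶠ k in Filter.atTop, chainCount l k G κ c = 0 := by
  filter_upwards [(Filter.eventually_all_finset c.support).2 fun s hs =>
    eventually_simplexCount_eq_zero l A hA hl κ s (hc s hs)] with k hk
  rw [chainCount, Finsupp.liftAddHom_apply]
  exact Finset.sum_eq_zero fun s hs => by simp [hk s hs]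

theorem chainCount_comp_perm {G : Type*} [AddCommGroup G] {n : ℕ} (κ : Fin n → V)
    (σ : Equiv.Perm (Fin n)) (c : C(stdSimplex ℝ (Fin n), X) →₀ G) :
    chainCount l k G (κ ∘ σ) c = (Equiv.Perm.sign σ : ℤ) • chainCount l k G κ c := by
  simp only [chainCount, Finsupp.liftAddHom_apply, simplexCount, tuplePairing_comp_perm,
    mul_smul, AddMonoidHom.coe_smul, Pi.smul_apply, Finsupp.smul_sum]
  rfl

theorem chainCount_eq_zero_of_not_injective {G : Type*} [AddCommGroup G] {n : ℕ} {κ : Fin n → V}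
    (hκ : ¬ Function.Injective κ) (c : C(stdSimplex ℝ (Fin n), X) →₀ G) :
    chainCount l k G κ c = 0 := by
  rw [chainCount, Finsupp.liftAddHom_apply]
  exact Finset.sum_eq_zero fun s _ => by
    simp [simplexCount, tuplePairing_eq_zero_of_not_injective hκ]

/-- Computes the coefficient in degree `-1`: subdivision fixes the empty tuple, and the empty
determinant is `1`. -/
theorem chainCount_zero_single {G : Type*} [AddCommGroup G] (κ : Fin 0 → V)
    (s : C(stdSimplex ℝ (Fin 0), X)) (g : G) : chainCount l k G κ (Finsupp.single s g) = g := by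
  have h : (chainSubdivision (stdSimplexAverage (Fin 0)) 0)^[k] = id :=
    (congrArg (·^[k]) (funext fun c => chainSubdivision_zero _ c)).trans (Function.iterate_id k)
  simp [chainCount, simplexCount, subdividedSimplex, h, tupleMap_single, tuplePairing_single,
    tupleDet]

end Count

/-! ### Filling chains and the conclusion -/

/-- Chains in a space indexed by tuples of vertices, filled in one dimension after the other within
the unions of the sets `A (ρ a)`, starting from `g` in degree `-1`. -/
noncomputable def fillingChain {G : Type*} [AddCommGroup G] {X V : Type*} [TopologicalSpace X]
    (A : V → Set X) (g : G) : ∀ n, (Fin n → V) → (C(stdSimplex ℝ (Fin n), X) →₀ G)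
  | 0, _ => Finsupp.single default g
  | n + 1, ρ =>
    open Classical in
    if h : ∃ c, singularBoundary G X n c =
        ∑ i : Fin (n + 1), (-1 : ℤ) ^ (i : ℕ) • fillingChain A g n (ρ ∘ i.succAbove) ∧
        ∀ s ∈ c.support, Set.range s ⊆ ⋃ a, A (ρ a)
    then h.choose else 0

/-- On strictly increasing tuples the default value `0` is never used: the alternating sum over the
faces is a cycle, by the specification one dimension lower, and is supported in the union, so
`hfill` applies. For one vertex, a constant simplex with coefficient `g` serves. -/
theorem fillingChain_spec {G : Type*} [AddCommGroup G] {X V : Type*} [TopologicalSpace X]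
    [Preorder V] (A : V → Set X) (g : G) (hne : ∀ v, (A v).Nonempty)
    (hfill : ∀ n (ρ : Fin (n + 2) → V), StrictMono ρ →
      ∀ z : C(stdSimplex ℝ (Fin (n + 1)), X) →₀ G, singularBoundary G X n z = 0 →
        (∀ s ∈ z.support, Set.range s ⊆ ⋃ a, A (ρ a)) →
        ∃ c, singularBoundary G X (n + 1) c = z ∧ ∀ s ∈ c.support, Set.range s ⊆ ⋃ a, A (ρ a))
    (n : ℕ) (ρ : Fin (n + 1) → V) (hρ : StrictMono ρ) :
    singularBoundary G X n (fillingChain A g (n + 1) ρ) =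
        ∑ i : Fin (n + 1), (-1 : ℤ) ^ (i : ℕ) • fillingChain A g n (ρ ∘ i.succAbove) ∧
      ∀ s ∈ (fillingChain A g (n + 1) ρ).support, Set.range s ⊆ ⋃ a, A (ρ a) := by
  suffices h : ∃ c, singularBoundary G X n c =
        ∑ i : Fin (n + 1), (-1 : ℤ) ^ (i : ℕ) • fillingChain A g n (ρ ∘ i.succAbove) ∧
        ∀ s ∈ c.support, Set.range s ⊆ ⋃ a, A (ρ a) by
    rw [fillingChain, dif_pos h]
    exact h.choose_spec
  induction n with
  | zero =>
    obtain ⟨x, hx⟩ := hne (ρ 0)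
    refine ⟨Finsupp.single (ContinuousMap.const _ x) g, ?_, fun s hs => ?_⟩
    · rw [singularBoundary_single]
      exact Finset.sum_congr rfl fun i _ => by rw [Subsingleton.elim (singularFace _ i) default,
        fillingChain]
    · obtain rfl := Finset.mem_singleton.1 (Finsupp.support_single_subset hs)
      rintro _ ⟨y, rfl⟩
      exact Set.mem_iUnion.2 ⟨0, hx⟩
  | succ n ih =>
    have ih' (i : Fin (n + 2)) : singularBoundary G X n
          (fillingChain A g (n + 1) (ρ ∘ i.succAbove)) = ∑ j : Fin (n + 1),
            (-1 : ℤ) ^ (j : ℕ) • fillingChain A g n ((ρ ∘ i.succAbove) ∘ j.succAbove) ∧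
        ∀ s ∈ (fillingChain A g (n + 1) (ρ ∘ i.succAbove)).support,
          Set.range s ⊆ ⋃ a, A ((ρ ∘ i.succAbove) a) := by
      have h := ih (ρ ∘ i.succAbove) (hρ.comp (Fin.strictMono_succAbove i))
      rw [fillingChain, dif_pos h]
      exact h.choose_spec
    refine hfill n ρ hρ _ ?_ fun s hs => ?_
    · simp only [map_sum, map_zsmul, (ih' _).1]
      exact sum_neg_one_pow_succAbove_succAbove fun f => fillingChain A g n (ρ ∘ f)
    · obtain ⟨i, -, hi⟩ := Finsupp.mem_support_finsetSum s hs
      exact ((ih' i).2 s (Finsupp.support_smul hi)).trans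
        (Set.iUnion_subset fun a => Set.subset_iUnion (fun b => A (ρ b)) (i.succAbove a))

/-- If the chains of a union of open sets can be filled as in `fillingChain_spec`, then the open
sets have a common point. -/
theorem nonempty_iInter_of_filling {G : Type*} [AddCommGroup G] [Nontrivial G] {X : Type*}
    [TopologicalSpace X] {m : ℕ} (A : Fin (m + 1) → Set X) (hA : ∀ v, IsOpen (A v))
    (hne : ∀ v, (A v).Nonempty)
    (hfill : ∀ n (ρ : Fin (n + 2) → Fin (m + 1)), StrictMono ρ →
      ∀ z : C(stdSimplex ℝ (Fin (n + 1)), X) →₀ G, singularBoundary G X n z = 0 →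
        (∀ s ∈ z.support, Set.range s ⊆ ⋃ a, A (ρ a)) →
        ∃ c, singularBoundary G X (n + 1) c = z ∧ ∀ s ∈ c.support, Set.range s ⊆ ⋃ a, A (ρ a)) :
    (⋂ v, A v).Nonempty := by
  by_contra hempty
  have hex (x : X) : ∃ v, x ∉ A v := by
    by_contra! h
    exact hempty ⟨x, Set.mem_iInter.2 h⟩
  choose l hl using hex
  obtain ⟨g, hg⟩ := exists_ne (0 : G)
  have hspec := fillingChain_spec A g hne hfill
  -- A strictly increasing tuple in `Fin (m + 1)` has at most `m + 1` entries, so finitely many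
  -- conditions arise and a single `k` meets them all.
  have hk : ∀ᶠ k in Filter.atTop, ∀ p : Σ n : Fin (m + 1), Fin (n + 1) → Fin (m + 1),
      StrictMono p.2 → chainCount l k G p.2 (fillingChain A g (p.1 + 1) p.2) = 0 := by
    refine Filter.eventually_all.2 fun p => ?_
    by_cases hp : StrictMono p.2
    · filter_upwards [eventually_chainCount_eq_zero l A hA hl p.2 _ (hspec p.1 p.2 hp).2] with k hk _
      exact hk
    · exact Filter.Eventually.of_forall fun k h => absurd h hp
  obtain ⟨k, hk⟩ := hk.exists
  have h0 := augmentation_eq_zero_of_forall_diagonal_eq_zero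
    (fun n ρ κ => chainCount l k G κ (fillingChain A g n ρ))
    (fun n ρ κ σ => chainCount_comp_perm l k κ σ _)
    (fun n ρ κ hκ => chainCount_eq_zero_of_not_injective l k hκ _)
    (fun n ρ κ hρ => by
      simp only [sum_chainCount_cons, (hspec n ρ hρ).1, map_sum, map_zsmul])
    (fun n ρ hρ => by
      have hn : n < m + 1 := by simpa using Fintype.card_le_of_injective ρ hρ.injective
      exact hk ⟨⟨n, hn⟩, ρ⟩ hρ)
    Fin.elim0
  rw [fillingChain, chainCount_zero_single] at h0
  exact hg h0

theorem mainTheorem6 {X : Type u} [TopologicalSpace X] (G : Type u) [AddCommGroup G] [Nontrivial G]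
    (m : ℕ) (hm : 1 ≤ m) (A : Fin m → Set X) (hA : ∀ i, IsOpen (A i))
    (hH : ∀ j : ℕ, 1 ≤ j → j ≤ m → ∀ s : Finset (Fin m), s.card = j →
      Subsingleton (reducedSingularHomology G (⋃ i ∈ s, A i : Set X) ((j : ℤ) - 2))) :
    (⋂ i, A i).Nonempty := by
  obtain ⟨m, rfl⟩ := Nat.exists_eq_add_of_le' hm
  refine nonempty_iInter_of_filling (G := G) A hA (fun v => ?_) fun n ρ hρ z hz hzU => ?_
  · have h := hH 1 le_rfl hm {v} (Finset.card_singleton v)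
    rw [show ((1 : ℕ) : ℤ) - 2 = -1 by norm_num,
      subsingleton_reducedSingularHomology_neg_one_iff, Set.nonempty_coe_sort] at h
    simpa using h
  -- The union has `j = n + 2` members, and a cycle of simplices with `n + 1` vertices has degree `n
  -- = j - 2`.
  · have hcard : (Finset.univ.map ⟨ρ, hρ.injective⟩).card = n + 2 := by simp
    have hU : ⋃ i ∈ Finset.univ.map ⟨ρ, hρ.injective⟩, A i = ⋃ a, A (ρ a) := by
      ext x
      simp
    have h := hH (n + 2) (by omega) (hcard ▸ card_finset_fin_le _) _ hcard
    rw [show ((n + 2 : ℕ) : ℤ) - 2 = n by push_cast; ring] at h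
    rw [← hU] at hzU ⊢
    exact exists_singularBoundary_eq_of_range_subset G _ n h z hz hzU
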